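/- Let $F/\mathbb{F}_q$ be an algebraic function field in one variable over a finite field $\mathbb{F}_q$. A place $P$ of $F/\mathbb{F}_q$ is the maximal ideal of a valuation ring $\mathcal{O}_P$ of $F$ with $\mathbb{F}_q\subseteq\mathcal{O}_P\subsetneq F$; $\nu_P$ denotes its discrete valuation, $\deg P=[\mathcal{O}_P/P:\mathbb{F}_q]$ its degree, and $P$ is rational if $\deg P=1$, in which case $f(P)\in\mathcal{O}_P/P=\mathbb{F}_q$ denotes the residue class of $f\in\mathcal{O}_P$. A divisor is a formal sum $G=\sum_P \nu_P(G)\,P$ over all places, with integer coefficients almost all zero; its support is $\operatorname{supp}G=\{P : \nu_P(G)\neq 0\}$, its degree is $\deg G=\sum_P \nu_P(G)\deg P$, and $\mathcal{L}(G)=\{f\in F^* : \nu_P(f)\ge-\nu_P(G)\text{ for all }P\}\cup\{0\}$. For divisors $G,H$ put $$G\cap H=\sum_P\min\{\nu_P(G),\nu_P(H)\}\,P,\qquad G\cup H=\sum_P\max\{\nu_P(G),\nu_P(H)\}\,P.$$ Let $P_1,\dots,P_n$ be pairwise distinct rational places of $F/\mathbb{F}_q$ and $D=P_1+\cdots+P_n$.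 For a divisor $G$ with $\operatorname{supp}G\cap\operatorname{supp}D=\varnothing$ let $$C_{\mathcal{L}}(D,G)=\{(f(P_1),\dots,f(P_n)) : f\in\mathcal{L}(G)\}\subseteq\mathbb{F}_q^n .$$ **Proposition.** Let $G_1,G_2$ be divisors of $F/\mathbb{F}_q$ such that $\operatorname{supp}G_1\cap\operatorname{supp}D=\varnothing$ and $\operatorname{supp}G_2\cap\operatorname{supp}D=\varnothing$. If $\deg(G_1\cup G_2)<n$, then $$C_{\mathcal{L}}(D,G_1)\cap C_{\mathcal{L}}(D,G_2)=C_{\mathcal{L}}(D,G_1\cap G_2).$$ -/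

import Mathlib

namespace AGCode

/-- A place of `F / k`, represented by its valuation ring `O_P`: a valuation ring of `F` that
contains the constants `k` and is not all of `F`.  (A place is the maximal ideal of its valuation
ring, and the two determine each other.) -/
structure Place (k F : Type*) [Field k] [Field F] [Algebra k F] where
  /-- The valuation ring `O_P` of the place. -/
  ring : ValuationSubring F
  algebraMap_mem : ∀ c : k, algebraMap k F c ∈ ring
  ne_top : ring ≠ ⊤

/-- A divisor of `F / k`: a formal `ℤ`-linear combination of finitely many places.  Its lattice
operations `⊓`, `⊔` are the coefficientwise minimum and maximum, i.e. the intersection and the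
union of divisors; `Finsupp.support` is the support of a divisor. -/
abbrev Divisor (k F : Type*) [Field k] [Field F] [Algebra k F] := Place k F →₀ ℤ

variable {k F : Type*} [Field k] [Field F] [Algebra k F]

namespace Place

/-- The valuation ring of a place is a `k`-algebra. -/
instance (P : Place k F) : Algebra k P.ring :=
  RingHom.toAlgebra
    { toFun := fun c => ⟨algebraMap k F c, P.algebraMap_mem c⟩
      map_one' := Subtype.ext (map_one _)
      map_zero' := Subtype.ext (map_zero _)
      map_add' := fun a b => Subtype.ext (map_add _ a b)
      map_mul' := fun a b => Subtype.ext (map_mul _ a b) }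

/-- The residue class field `O_P / P`. -/
abbrev ResidueField (P : Place k F) := IsLocalRing.ResidueField P.ring

/-- The degree of a place: the dimension over `k` of its residue class field. -/
noncomputable def degree (P : Place k F) : ℕ := Module.finrank k P.ResidueField

/-- A rational place is a place of degree one. -/
def IsRational (P : Place k F) : Prop := P.degree = 1

/-- A prime element of a place: a generator of the maximal ideal of `O_P`. -/
def IsPrimeElement (P : Place k F) (t : P.ring) : Prop :=
  IsLocalRing.maximalIdeal P.ring = Ideal.span {t}

open Classical in
/-- The discrete valuation `ν_P` on nonzero elements: `ν_P(f) = m` if `f = t ^ m * u` with `t` a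
prime element of `P` and `u` a unit of `O_P`.  In an algebraic function field every `f ≠ 0` has
such a decomposition, and `m` depends neither on it nor on `t`.  The value at `f = 0` is a
placeholder and is not used. -/
noncomputable def ord (P : Place k F) (f : F) : ℤ :=
  if h : ∃ m : ℤ, ∃ t : P.ring, P.IsPrimeElement t ∧
      ∃ u : P.ringˣ, f = (t : F) ^ m * ((u : P.ring) : F)
  then h.choose else 0

theorem IsRational.bijective {P : Place k F} (hP : P.IsRational) :
    Function.Bijective (algebraMap k P.ResidueField) :=
  Algebra.finrank_eq_one_iff_bijective_algebraMap.mp hP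

/-- Evaluation at a rational place, `f ↦ f(P)`: the residue class of `f` modulo `P`, where
`O_P / P` is identified with `k` through the structure map `k → O_P / P`, an isomorphism. -/
noncomputable def evalAt (P : Place k F) (hP : P.IsRational) : P.ring →ₐ[k] k :=
  ((AlgEquiv.ofBijective (Algebra.ofId k P.ResidueField) hP.bijective).symm : _ →ₐ[k] k).comp
    (IsScalarTower.toAlgHom k P.ring P.ResidueField)

end Place

/-- The degree of a divisor. -/
noncomputable def Divisor.degree (G : Divisor k F) : ℤ :=
  G.sum fun P m => m * (P.degree : ℤ)

/-- The Riemann–Roch space `L(G) = {f ∈ F^* | (f) ≥ -G} ∪ {0}`. -/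
def riemannRochSpace (G : Divisor k F) : Set F :=
  {f | f ≠ 0 ∧ ∀ P : Place k F, -(G P) ≤ P.ord f} ∪ {0}

/-- The divisor `D = P_1 + ⋯ + P_n`. -/
noncomputable def sumOfPlaces {n : ℕ} (P : Fin n → Place k F) : Divisor k F :=
  ∑ i, Finsupp.single (P i) 1

/-- The algebraic-geometry code
`C_L(D, G) = {(f(P_1), …, f(P_n)) | f ∈ L(G)} ⊆ k ^ n` for `D = P_1 + ⋯ + P_n`.
It is used when the supports of `G` and `D` are disjoint; then every `f ∈ L(G)` lies in all the
rings `O_{P_i}`, so that all its values are defined. -/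
def code {n : ℕ} (P : Fin n → Place k F) (hP : ∀ i, (P i).IsRational) (G : Divisor k F) :
    Set (Fin n → k) :=
  {c | ∃ f ∈ riemannRochSpace G, ∃ hf : ∀ i, f ∈ (P i).ring,
    c = fun i => (P i).evalAt (hP i) ⟨f, hf i⟩}

end AGCode

open Polynomial

namespace AGCode

/-! If `f ∈ L(G₁)` and `g ∈ L(G₂)` give the same codeword, then `h = f - g` lies in `L(G₁ ∪ G₂)` and
vanishes at all `n` rational places. If `h ≠ 0`, the divisor `G₁ ∪ G₂ + (h)` is effective with
coefficient at least 1 at each `P_i`, so its degree is at least `n`. Since `(h)` has degree at most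
0, this contradicts the degree bound. So `f = g`, which lies in `L(G₁) ∩ L(G₂) = L(G₁ ∩ G₂)`. The
other inclusion is monotonicity of `L`.

The substance is `deg (h) ≤ 0`, over a finite set of places containing all poles. For transcendental
`h` it follows from two estimates against `[F : k(h)]`: zeros have total degree at most this
(`sum_ord_mul_degree_le_finrank`: weak approximation, and lifting independence modulo `h` to
independence over `k(h)`), poles at least this (`finrank_le_sum_neg_ord_mul_degree`: counting
products of powers of `h` with an integral basis). An algebraic `h` has order 0 everywhere. Both
estimates rest on `dim O_P/(a) = ν_P(a) deg P`. -/

theorem finiteDimensional_adjoin_of_transcendental {k F : Type*} [Field k] [Field F] [Algebra k F]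
    [Algebra (RatFunc k) F] [IsScalarTower k (RatFunc k) F] [FunctionField k F]
    {h : F} (hh : Transcendental k h) :
    FiniteDimensional (IntermediateField.adjoin k {h}) F := by
  have : Algebra.IsAlgebraic k[X] (RatFunc k) := IsLocalization.isAlgebraic _ (nonZeroDivisors k[X])
  have h1 : Algebra.trdeg k (RatFunc k) = 1 := by
    rw [← trdeg_add_eq k k[X] (A := RatFunc k), trdeg_eq_zero_iff.2 this,
      Polynomial.trdeg_of_isDomain, add_zero]
  have h2 := lift_trdeg_add_eq k (RatFunc k) F
  have h3 : Algebra.trdeg k F = 1 := by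
    rw [h1, trdeg_eq_zero_iff.2 (inferInstance : Algebra.IsAlgebraic (RatFunc k) F)] at h2
    simpa using h2.symm
  have hind : AlgebraicIndependent k (fun _ : Unit => h) :=
    algebraicIndependent_unique_type_iff.2 hh
  -- In transcendence degree one, `h` alone is a transcendence basis, so `F` is algebraic over
  -- `k(h)`. Finiteness then comes from `F` being essentially of finite type.
  have hb := hind.isTranscendenceBasis_of_lift_trdeg_le_of_finite (by simp [h3])
  have halg := hb.isAlgebraic_field
  rw [Set.range_const] at halg
  have : Algebra.EssFiniteType k[X] (RatFunc k) :=
    Algebra.EssFiniteType.of_isLocalization _ (nonZeroDivisors k[X])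
  have : Algebra.EssFiniteType k (RatFunc k) := Algebra.EssFiniteType.comp k k[X] _
  have : Algebra.EssFiniteType k F := Algebra.EssFiniteType.comp k (RatFunc k) F
  have : Algebra.EssFiniteType (IntermediateField.adjoin k {h}) F :=
    Algebra.EssFiniteType.of_comp k _ F
  exact Algebra.finite_of_essFiniteType_of_isAlgebraic

/-! ### Dimensions of quotients by principal ideals -/

section Quotient

variable {k F R : Type*} [Field k] [Field F] [Algebra k F] [CommRing R] [Algebra k R]

/-- Elements that are linearly independent modulo `x` satisfy no nontrivial relation with
coefficients in `k[x]`. -/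
theorem eq_zero_of_sum_aeval_mul_eq_zero {ι : Type*} [Fintype ι] {x : R}
    (hx : x ∈ nonZeroDivisors R) {z : ι → R}
    (hz : LinearIndependent k fun i => Ideal.Quotient.mk (Ideal.span {x}) (z i))
    (p : ι → k[X]) (hp : ∑ i, aeval x (p i) * z i = 0) : p = 0 := by
  -- Descent: modulo `x` the relation involves only constant terms, which vanish by independence;
  -- cancelling the regular element `x` leaves a relation of the same kind.
  have key : ∀ N : ℕ, ∀ p : ι → k[X], ∑ i, aeval x (p i) * z i = 0 → ∀ i, X ^ N ∣ p i := by
    intro N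
    induction N with
    | zero => intro p _ i; simp
    | succ N ih =>
      intro p hp
      have hX : ∀ i, X ∣ p i := by
        have h0 := congrArg (Ideal.Quotient.mk (Ideal.span {x})) hp
        have hxx : Ideal.Quotient.mk (Ideal.span {x}) x = 0 :=
          Ideal.Quotient.eq_zero_iff_mem.2 (Ideal.mem_span_singleton_self x)
        have hev : ∀ q : k[X], Ideal.Quotient.mk (Ideal.span {x}) (aeval x q)
            = algebraMap k _ (q.coeff 0) := by
          intro q
          have := (Polynomial.aeval_algHom_apply (Ideal.Quotient.mkₐ k (Ideal.span {x})) x q).symm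
          simp only [Ideal.Quotient.mkₐ_eq_mk, hxx] at this
          rw [this, Polynomial.aeval_def, Polynomial.eval₂_at_zero]
        simp only [map_sum, map_mul, map_zero, hev, ← Algebra.smul_def] at h0
        intro i
        exact X_dvd_iff.2 (Fintype.linearIndependent_iff.1 hz _ h0 i)
      choose q hq using hX
      have hq0 : ∑ i, aeval x (q i) * z i = 0 := by
        have : (∑ i, aeval x (q i) * z i) * x = 0 := by
          rw [← hp, Finset.sum_mul]
          refine Finset.sum_congr rfl fun i _ => ?_
          rw [hq i, map_mul, aeval_X]
          ring
        exact (mem_nonZeroDivisors_iff.1 hx).2 _ this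
      intro i
      rw [hq i, pow_succ, mul_comm]
      exact mul_dvd_mul_left _ (ih q hq0 i)
  funext i
  by_contra hne
  have h1 := Polynomial.natDegree_le_of_dvd (key ((p i).natDegree + 1) p hp i) hne
  simp at h1

/-- As `k(φ x)` is the fraction field of `k[φ x]`, denominators clear and only polynomial relations
matter. -/
theorem linearIndependent_adjoin_of_quotient {ι : Type*} [Fintype ι] (φ : R →ₐ[k] F)
    (hφ : Function.Injective φ) {x : R} (hx : x ≠ 0) {z : ι → R}
    (hz : LinearIndependent k fun i => Ideal.Quotient.mk (Ideal.span {x}) (z i)) :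
    LinearIndependent (IntermediateField.adjoin k {φ x}) fun i => φ (z i) := by
  open IntermediateField.algebraAdjoinAdjoin in
  rw [← LinearIndependent.iff_fractionRing (R := Algebra.adjoin k {φ x}), Fintype.linearIndependent_iff]
  intro g hg
  have : ∀ i, ∃ p : k[X], aeval (φ x) p = (g i : F) := fun i =>
    (Algebra.adjoin_singleton_eq_range_aeval k (φ x)).le (g i).2
  choose p hp using this
  have hR : IsDomain R := hφ.isDomain φ.toRingHom
  have h0 : ∑ i, aeval x (p i) * z i = 0 := by
    apply hφ
    rw [map_sum, map_zero, ← hg]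
    refine Finset.sum_congr rfl fun i _ => ?_
    rw [map_mul, ← Polynomial.aeval_algHom_apply, hp i]
    rfl
  have := eq_zero_of_sum_aeval_mul_eq_zero (mem_nonZeroDivisors_of_ne_zero hx) hz p h0
  intro i
  apply Subtype.ext
  rw [← hp i, this]
  simp

/-- Used for a single valuation ring, to get finiteness, and for an intersection of several, to
bound zeros. -/
theorem finite_quotient_and_finrank_le (φ : R →ₐ[k] F) (hφ : Function.Injective φ) {x : R}
    (hx : x ≠ 0) [FiniteDimensional (IntermediateField.adjoin k {φ x}) F] :
    Module.Finite k (R ⧸ Ideal.span {x}) ∧ Module.finrank k (R ⧸ Ideal.span {x}) ≤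
      Module.finrank (IntermediateField.adjoin k {φ x}) F := by
  have h : Module.rank k (R ⧸ Ideal.span {x}) ≤
      (Module.finrank (IntermediateField.adjoin k {φ x}) F : ℕ) := by
    refine rank_le fun s hs => ?_
    have hz : ∀ i : s, ∃ r : R, Ideal.Quotient.mk (Ideal.span {x}) r = i.1 :=
      fun i => Ideal.Quotient.mk_surjective _
    choose z hz using hz
    have := linearIndependent_adjoin_of_quotient φ hφ hx (z := z) (by simpa only [hz] using hs)
    simpa using this.fintype_card_le_finrank
  have hfin : Module.Finite k (R ⧸ Ideal.span {x}) :=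
    Module.rank_lt_aleph0_iff.1 (h.trans_lt Cardinal.natCast_lt_aleph0)
  refine ⟨hfin, ?_⟩
  rw [← Module.finrank_eq_rank] at h
  exact_mod_cast h

/-- Exactness of `0 → R/b → R/ab → R/a → 0`, the first map being multiplication by `a`. -/
theorem finrank_quotient_span_mul [IsDomain R] {a b : R} (ha : a ≠ 0)
    [Module.Finite k (R ⧸ Ideal.span {a * b})] :
    Module.finrank k (R ⧸ Ideal.span {a * b}) =
      Module.finrank k (R ⧸ Ideal.span {a}) + Module.finrank k (R ⧸ Ideal.span {b}) := by
  have hle : Ideal.span {a * b} ≤ Ideal.span {a} :=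
    (Ideal.span_singleton_le_span_singleton).2 (dvd_mul_right a b)
  let g : (R ⧸ Ideal.span {a * b}) →ₗ[k] (R ⧸ Ideal.span {a}) :=
    (Ideal.Quotient.factorₐ k hle).toLinearMap
  have hmem : ∀ r : R, a * r ∈ Ideal.span {a * b} ↔ r ∈ Ideal.span {b} := fun r => by
    rw [Ideal.mem_span_singleton, Ideal.mem_span_singleton, mul_dvd_mul_iff_left ha]
  let f : (R ⧸ Ideal.span {b}) →ₗ[k] (R ⧸ Ideal.span {a * b}) :=
    ((Ideal.span {b}).restrictScalars k).mapQ ((Ideal.span {a * b}).restrictScalars k)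
      (LinearMap.mulLeft k a) fun r hr => (hmem r).2 hr
  have hf : ∀ r, f (Ideal.Quotient.mk _ r) = Ideal.Quotient.mk _ (a * r) := fun _ => rfl
  have hg : ∀ r, g (Ideal.Quotient.mk _ r) = Ideal.Quotient.mk _ r := fun _ => rfl
  have hfi : Function.Injective f := by
    rw [injective_iff_map_eq_zero]
    intro y hy
    obtain ⟨r, rfl⟩ := Ideal.Quotient.mk_surjective y
    rw [hf, Ideal.Quotient.eq_zero_iff_mem, hmem] at hy
    exact Ideal.Quotient.eq_zero_iff_mem.2 hy
  have hgs : Function.Surjective g := by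
    intro y
    obtain ⟨r, rfl⟩ := Ideal.Quotient.mk_surjective y
    exact ⟨_, hg r⟩
  have hex : LinearMap.ker g = LinearMap.range f := by
    ext y
    obtain ⟨r, rfl⟩ := Ideal.Quotient.mk_surjective y
    rw [LinearMap.mem_ker, hg, Ideal.Quotient.eq_zero_iff_mem, Ideal.mem_span_singleton]
    constructor
    · rintro ⟨c, rfl⟩
      exact ⟨_, hf c⟩
    · rintro ⟨y, hy⟩
      obtain ⟨c, rfl⟩ := Ideal.Quotient.mk_surjective y
      rw [hf, Ideal.Quotient.eq] at hy
      have := hle hy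
      rw [Ideal.mem_span_singleton] at this
      exact (dvd_sub_right (dvd_mul_right a c)).1 this
  rw [← g.finrank_range_add_finrank_ker, hex, LinearMap.finrank_range_of_inj hfi,
    LinearMap.range_eq_top.2 hgs, finrank_top]

end Quotient

/-- Over every transcendental element, the field `F` is finite: the property of function fields in
one variable that the theory of places uses. -/
class FiniteOverTranscendental (k F : Type*) [Field k] [Field F] [Algebra k F] : Prop where
  finite_adjoin : ∀ h : F, Transcendental k h → FiniteDimensional (IntermediateField.adjoin k {h}) F

variable {k F : Type*} [Field k] [Field F] [Algebra k F]

/-! ### Valuation rings of places are discrete -/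

namespace Place

variable (P : Place k F)

/-- The valuation ring of a place, as a subalgebra. -/
def subalgebra : Subalgebra k F where
  __ := P.ring.toSubring
  algebraMap_mem' := P.algebraMap_mem

/-- The inclusion of the valuation ring of a place. -/
def val : P.ring →ₐ[k] F :=
  { P.ring.subtype with commutes' := fun _ => rfl }

theorem val_injective : Function.Injective P.val := Subtype.val_injective

/-- The inverse of a nonzero algebraic element of `O_P` again lies in `O_P`, making the element a
unit. -/
theorem transcendental_of_mem_maximalIdeal {a : P.ring} (ha : a ∈ IsLocalRing.maximalIdeal P.ring)
    (ha0 : a ≠ 0) : Transcendental k (a : F) := by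
  intro halg
  have hinv : (a : F)⁻¹ ∈ P.ring := halg.isIntegral.inv_mem (A := P.subalgebra) a.2
  refine (IsLocalRing.mem_maximalIdeal a).1 ha (IsUnit.of_mul_eq_one ⟨_, hinv⟩ (Subtype.ext ?_))
  exact mul_inv_cancel₀ fun h => ha0 (Subtype.ext h)

theorem maximalIdeal_ne_bot : IsLocalRing.maximalIdeal P.ring ≠ ⊥ := by
  intro h
  refine P.ne_top (eq_top_iff.2 fun x _ => ?_)
  by_contra hx
  have hx0 : x ≠ 0 := fun h0 => hx (h0 ▸ P.ring.zero_mem)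
  have hinv := (P.ring.mem_or_inv_mem x).resolve_left hx
  have hu : IsUnit (⟨x⁻¹, hinv⟩ : P.ring) := by
    by_contra hu
    have := (IsLocalRing.mem_maximalIdeal _).2 hu
    rw [h, Ideal.mem_bot] at this
    exact inv_ne_zero hx0 (congrArg Subtype.val this)
  obtain ⟨b, hb⟩ := hu.exists_right_inv
  have hb' : x⁻¹ * (b : F) = 1 := congrArg Subtype.val hb
  have : x = b := by field_simp at hb'; exact hb'.symm
  exact hx (this ▸ b.2)

theorem coe_unit_ne_zero {P : Place k F} (u : P.ringˣ) : ((u : P.ring) : F) ≠ 0 :=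
  fun h => u.ne_zero (Subtype.ext h)

theorem coe_unit_inv {P : Place k F} (u : P.ringˣ) : (((u⁻¹ : P.ringˣ) : P.ring) : F) = ((u : P.ring) : F)⁻¹ :=
  eq_inv_of_mul_eq_one_left (congrArg Subtype.val u.inv_mul)

variable [FiniteOverTranscendental k F]

theorem finite_quotient {a : P.ring} (ha : a ≠ 0) :
    Module.Finite k (P.ring ⧸ Ideal.span {a}) := by
  by_cases hu : IsUnit a
  · have : Subsingleton (P.ring ⧸ Ideal.span {a}) :=
      Ideal.Quotient.subsingleton_iff.2 (Ideal.span_singleton_eq_top.2 hu)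
    infer_instance
  · have := FiniteOverTranscendental.finite_adjoin _
      (P.transcendental_of_mem_maximalIdeal ((IsLocalRing.mem_maximalIdeal a).2 hu) ha)
    have : FiniteDimensional (IntermediateField.adjoin k {P.val a}) F := this
    exact (finite_quotient_and_finrank_le P.val P.val_injective ha).1

/-- For `0 ≠ y ∈ I`, the image of `I` in the finite-dimensional `O_P/(y)` is finitely generated, and
the kernel `(y)` is principal. -/
instance isNoetherianRing : IsNoetherianRing P.ring := by
  refine (isNoetherianRing_iff_ideal_fg _).2 fun I => ?_
  by_cases hI : I = ⊥
  · rw [hI]; exact Submodule.fg_bot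
  obtain ⟨y, hy, hy0⟩ := Submodule.exists_mem_ne_zero_of_ne_bot hI
  have := P.finite_quotient hy0
  have hn : IsNoetherian k (P.ring ⧸ Ideal.span {y}) := inferInstance
  have hn' : IsNoetherian P.ring (P.ring ⧸ Ideal.span {y}) :=
    isNoetherian_of_tower k hn
  refine Submodule.fg_of_fg_map_of_fg_inf_ker (Ideal.span {y}).mkQ (IsNoetherian.noetherian _) ?_
  rw [Submodule.ker_mkQ, inf_eq_right.2 ((Ideal.span_singleton_le_iff_mem I).2 hy)]
  exact Submodule.fg_span_singleton y

instance isDiscreteValuationRing : IsDiscreteValuationRing P.ring :=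
  have : IsPrincipalIdealRing P.ring := (IsBezout.TFAE.out 0 1).1 P.isNoetherianRing
  { not_a_field' := P.maximalIdeal_ne_bot }

theorem isPrimeElement_iff {t : P.ring} : P.IsPrimeElement t ↔ Irreducible t :=
  (IsDiscreteValuationRing.irreducible_iff_uniformizer t).symm

theorem exists_isPrimeElement : ∃ t, P.IsPrimeElement t := by
  obtain ⟨t, ht⟩ := IsDiscreteValuationRing.exists_irreducible P.ring
  exact ⟨t, P.isPrimeElement_iff.2 ht⟩

variable {P}

theorem IsPrimeElement.coe_ne_zero {t : P.ring} (ht : P.IsPrimeElement t) : (t : F) ≠ 0 :=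
  fun h => (P.isPrimeElement_iff.1 ht).ne_zero (Subtype.ext h)

theorem IsPrimeElement.exists_eq_zpow_mul {t : P.ring} (ht : P.IsPrimeElement t) {f : F}
    (hf : f ≠ 0) : ∃ m : ℤ, ∃ u : P.ringˣ, f = (t : F) ^ m * ((u : P.ring) : F) := by
  obtain ⟨m, u, h⟩ := IsDiscreteValuationRing.exists_units_eq_smul_zpow_of_irreducible
    (P.isPrimeElement_iff.1 ht) hf
  exact ⟨m, u, by rw [h, mul_comm]; rfl⟩

theorem IsPrimeElement.nonneg_of_zpow_mul_mem {t : P.ring} (ht : P.IsPrimeElement t) {m : ℤ}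
    {u : P.ringˣ} (h : (t : F) ^ m * ((u : P.ring) : F) ∈ P.ring) : 0 ≤ m := by
  by_contra! hm
  obtain ⟨n, hn⟩ := Int.eq_ofNat_of_zero_le (neg_nonneg.2 hm.le)
  have hn0 : n ≠ 0 := by rintro rfl; simp at hn; omega
  have hm' : m = -(n : ℤ) := by omega
  refine (P.isPrimeElement_iff.1 ht).not_isUnit ((isUnit_pow_iff hn0).1 ?_)
  refine IsUnit.of_mul_eq_one (⟨_, h⟩ * ↑u⁻¹) (Subtype.ext ?_)
  change ((t : F) ^ n) * ((t : F) ^ m * ((u : P.ring) : F) * (((u⁻¹ : P.ringˣ) : P.ring) : F)) = 1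
  rw [coe_unit_inv, mul_assoc, mul_inv_cancel₀ (coe_unit_ne_zero u), hm', zpow_neg, zpow_natCast,
    mul_one, mul_inv_cancel₀ (pow_ne_zero _ ht.coe_ne_zero)]

/-- The choice in `ord` is harmless: prime elements are associated, so two decompositions make `t ^
(m - m')` and its inverse both lie in `O_P`. -/
theorem IsPrimeElement.ord_eq {t : P.ring} (ht : P.IsPrimeElement t) (m : ℤ) (u : P.ringˣ) :
    P.ord ((t : F) ^ m * ((u : P.ring) : F)) = m := by
  have hex : ∃ m' : ℤ, ∃ t' : P.ring, P.IsPrimeElement t' ∧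
      ∃ u' : P.ringˣ, (t : F) ^ m * ((u : P.ring) : F) = (t' : F) ^ m' * ((u' : P.ring) : F) :=
    ⟨m, t, ht, u, rfl⟩
  rw [ord, dif_pos hex]
  obtain ⟨t', ht', u', h⟩ := hex.choose_spec
  generalize hex.choose = m' at h
  obtain ⟨w, hw⟩ := IsDiscreteValuationRing.associated_of_irreducible P.ring
    (P.isPrimeElement_iff.1 ht) (P.isPrimeElement_iff.1 ht')
  have hw' : (t' : F) = t * ((w : P.ring) : F) := congrArg Subtype.val hw.symm
  have ht0 := ht.coe_ne_zero
  have hwz : (((w ^ m' : P.ringˣ) : P.ring) : F) = ((w : P.ring) : F) ^ m' := by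
    rcases m' with n | n
    · simp
    · rw [zpow_negSucc, zpow_negSucc, coe_unit_inv]; simp
  have e1 : (t : F) ^ (m - m') * (((1 : P.ringˣ) : P.ring) : F) =
      (((w ^ m' * u' * u⁻¹ : P.ringˣ) : P.ring) : F) := by
    have : (((w ^ m' * u' * u⁻¹ : P.ringˣ) : P.ring) : F) =
        ((w : P.ring) : F) ^ m' * ((u' : P.ring) : F) * ((u : P.ring) : F)⁻¹ := by
      rw [← hwz, ← coe_unit_inv]; rfl
    rw [this, zpow_sub₀ ht0, eq_mul_inv_iff_mul_eq₀ (coe_unit_ne_zero u)]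
    have h1 : (((1 : P.ringˣ) : P.ring) : F) = 1 := rfl
    rw [hw', mul_zpow] at h
    rw [h1, mul_one, div_mul_eq_mul_div, h]
    field_simp
  have e2 : (t : F) ^ (m' - m) * (((1 : P.ringˣ) : P.ring) : F) =
      ((((w ^ m' * u' * u⁻¹)⁻¹ : P.ringˣ) : P.ring) : F) := by
    have h1 : (((1 : P.ringˣ) : P.ring) : F) = 1 := rfl
    rw [coe_unit_inv, ← e1, h1, mul_one, mul_one, ← zpow_neg, neg_sub]
  have i1 := ht.nonneg_of_zpow_mul_mem (e1 ▸ Subtype.property _)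
  have i2 := ht.nonneg_of_zpow_mul_mem (e2 ▸ Subtype.property _)
  omega

/-! ### Arithmetic of the order function -/

variable {f g : F}

theorem ord_mul (hf : f ≠ 0) (hg : g ≠ 0) : P.ord (f * g) = P.ord f + P.ord g := by
  obtain ⟨t, ht⟩ := P.exists_isPrimeElement
  obtain ⟨m, u, rfl⟩ := ht.exists_eq_zpow_mul hf
  obtain ⟨n, v, rfl⟩ := ht.exists_eq_zpow_mul hg
  rw [ht.ord_eq, ht.ord_eq, ← ht.ord_eq (m + n) (u * v), zpow_add₀ ht.coe_ne_zero]
  congr 1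
  push_cast
  ring

theorem ord_one : P.ord (1 : F) = 0 := by
  have := P.ord_mul (one_ne_zero (α := F)) one_ne_zero
  rw [mul_one] at this
  omega

theorem ord_neg (hf : f ≠ 0) : P.ord (-f) = P.ord f := by
  have h1 : (-1 : F) ≠ 0 := by simp
  have h2 := P.ord_mul h1 h1
  rw [neg_mul_neg, one_mul, ord_one] at h2
  rw [← neg_one_mul, ord_mul h1 hf]
  omega

theorem ord_inv (hf : f ≠ 0) : P.ord f⁻¹ = -P.ord f := by
  have := P.ord_mul hf (inv_ne_zero hf)
  rw [mul_inv_cancel₀ hf, ord_one] at this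
  omega

theorem ord_pow (hf : f ≠ 0) (n : ℕ) : P.ord (f ^ n) = n * P.ord f := by
  induction n with
  | zero => simp [ord_one]
  | succ n ih => rw [pow_succ, ord_mul (pow_ne_zero n hf) hf, ih]; push_cast; ring

theorem mem_ring_iff (hf : f ≠ 0) : f ∈ P.ring ↔ 0 ≤ P.ord f := by
  obtain ⟨t, ht⟩ := P.exists_isPrimeElement
  obtain ⟨m, u, rfl⟩ := ht.exists_eq_zpow_mul hf
  rw [ht.ord_eq]
  refine ⟨ht.nonneg_of_zpow_mul_mem, fun h => ?_⟩
  obtain ⟨n, rfl⟩ := Int.eq_ofNat_of_zero_le h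
  exact P.ring.mul_mem _ _ (by simpa using pow_mem t.2 n) (Subtype.property _)

theorem mem_maximalIdeal_iff {a : P.ring} (ha : a ≠ 0) :
    a ∈ IsLocalRing.maximalIdeal P.ring ↔ 0 < P.ord (a : F) := by
  have ha' : (a : F) ≠ 0 := fun h => ha (Subtype.ext h)
  have h0 := (mem_ring_iff ha').1 a.2
  rw [IsLocalRing.mem_maximalIdeal, mem_nonunits_iff, ← not_iff_not, not_not, not_lt]
  constructor
  · intro hu
    obtain ⟨b, hb⟩ := hu.exists_right_inv
    have hb' : (a : F) * b = 1 := congrArg Subtype.val hb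
    have hinv : (a : F)⁻¹ = b := inv_eq_of_mul_eq_one_right hb'
    have := (mem_ring_iff (inv_ne_zero ha')).1 (hinv ▸ b.2)
    rw [ord_inv ha'] at this
    omega
  · intro h
    have hinv : (a : F)⁻¹ ∈ P.ring := (mem_ring_iff (inv_ne_zero ha')).2 (by
      rw [ord_inv ha']; omega)
    exact IsUnit.of_mul_eq_one ⟨_, hinv⟩ (Subtype.ext (mul_inv_cancel₀ ha'))

theorem min_ord_le_ord_add (hf : f ≠ 0) (hg : g ≠ 0) (hfg : f + g ≠ 0) :
    min (P.ord f) (P.ord g) ≤ P.ord (f + g) := by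
  wlog h : P.ord f ≤ P.ord g generalizing f g
  · rw [min_comm, add_comm]
    exact this hg hf (by rwa [add_comm]) (le_of_not_ge h)
  rw [min_eq_left h]
  have h1 : g * f⁻¹ ∈ P.ring := (mem_ring_iff (mul_ne_zero hg (inv_ne_zero hf))).2 (by
    rw [ord_mul hg (inv_ne_zero hf), ord_inv hf]; omega)
  have h2 : f + g = f * (1 + g * f⁻¹) := by field_simp
  have h3 : 1 + g * f⁻¹ ≠ 0 := fun h0 => hfg (by rw [h2, h0, mul_zero])
  have h4 := (mem_ring_iff h3).1 (P.ring.add_mem _ _ P.ring.one_mem h1)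
  rw [h2, ord_mul hf h3]
  omega

theorem transcendental_of_ord_ne_zero (hf : f ≠ 0) (h : P.ord f ≠ 0) : Transcendental k f := by
  rcases lt_or_gt_of_ne h with h | h
  · have hpos : 0 < P.ord f⁻¹ := by rw [ord_inv hf]; omega
    have hm := (mem_ring_iff (inv_ne_zero hf)).2 hpos.le
    have h0 : (⟨_, hm⟩ : P.ring) ≠ 0 := fun h0 => inv_ne_zero hf (congrArg Subtype.val h0)
    intro halg
    exact P.transcendental_of_mem_maximalIdeal ((mem_maximalIdeal_iff h0).2 hpos) h0 halg.inv
  · have hm := (mem_ring_iff hf).2 (le_of_lt h)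
    have h0 : (⟨_, hm⟩ : P.ring) ≠ 0 := fun h0 => hf (congrArg Subtype.val h0)
    exact P.transcendental_of_mem_maximalIdeal ((mem_maximalIdeal_iff h0).2 h) h0

/-- Each factor `t` of `a` contributes one copy of the residue field `O_P/(t)`. -/
theorem finrank_quotient_span {a : P.ring} (ha : a ≠ 0) :
    (Module.finrank k (P.ring ⧸ Ideal.span {a}) : ℤ) = P.ord (a : F) * P.degree := by
  obtain ⟨t, ht⟩ := P.exists_isPrimeElement
  have htirr := P.isPrimeElement_iff.1 ht
  obtain ⟨n, u, rfl⟩ := IsDiscreteValuationRing.eq_unit_mul_pow_irreducible ha htirr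
  have hord : P.ord (((u : P.ring) * t ^ n : P.ring) : F) = n := by
    rw [← ht.ord_eq n u, mul_comm]
    simp
  have hspan : Ideal.span {(u : P.ring) * t ^ n} = Ideal.span {t ^ n} :=
    Ideal.span_singleton_mul_left_unit u.isUnit _
  rw [hord, hspan]
  clear hord hspan ha
  induction n with
  | zero =>
    have : Subsingleton (P.ring ⧸ Ideal.span {t ^ 0}) :=
      Ideal.Quotient.subsingleton_iff.2 (by simp)
    simp [Module.finrank_zero_of_subsingleton]
  | succ n ih =>
    have := P.finite_quotient (a := t * t ^ n) (mul_ne_zero htirr.ne_zero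
      (pow_ne_zero _ htirr.ne_zero))
    rw [pow_succ', finrank_quotient_span_mul htirr.ne_zero]
    have hdeg : Module.finrank k (P.ring ⧸ Ideal.span {t}) = P.degree := by
      have h : IsLocalRing.maximalIdeal P.ring = Ideal.span {t} := ht
      rw [← h]; rfl
    push_cast
    rw [ih, hdeg]
    ring

end Place

/-! ### Weak approximation and the count of zeros -/

namespace Place

theorem ring_injective : Function.Injective (Place.ring : Place k F → ValuationSubring F) := by
  rintro ⟨R, _, _⟩ ⟨S, _, _⟩ h
  simpa using h

variable [FiniteOverTranscendental k F]

open Classical in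
/-- The absolute value `f ↦ 2 ^ (-ν_P(f))` of a place. -/
noncomputable def abv (P : Place k F) : AbsoluteValue F ℝ where
  toFun f := if f = 0 then 0 else (2 : ℝ) ^ (-P.ord f)
  map_mul' f g := by
    by_cases hf : f = 0
    · simp [hf]
    by_cases hg : g = 0
    · simp [hg]
    rw [if_neg hf, if_neg hg, if_neg (mul_ne_zero hf hg), ord_mul hf hg, neg_add,
      zpow_add₀ two_ne_zero]
  nonneg' f := by
    split_ifs <;> positivity
  eq_zero' f := by
    split_ifs with h
    · simp [h]
    · simp only [h, iff_false]; positivity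
  add_le' f g := by
    by_cases hf : f = 0
    · simp [hf]
    by_cases hg : g = 0
    · simp [hg]
    by_cases hfg : f + g = 0
    · rw [if_pos hfg, if_neg hf, if_neg hg]; positivity
    rw [if_neg hf, if_neg hg, if_neg hfg]
    have h2 : (1 : ℝ) ≤ 2 := one_le_two
    have p1 : (0 : ℝ) < 2 ^ (-P.ord f) := by positivity
    have p2 : (0 : ℝ) < 2 ^ (-P.ord g) := by positivity
    rcases min_le_iff.1 (min_ord_le_ord_add hf hg hfg (P := P)) with h | h
    · linarith [zpow_le_zpow_right₀ h2 (neg_le_neg h)]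
    · linarith [zpow_le_zpow_right₀ h2 (neg_le_neg h)]

variable {P : Place k F} {f : F}

theorem abv_apply (hf : f ≠ 0) : P.abv f = (2 : ℝ) ^ (-P.ord f) := if_neg hf

theorem one_lt_abv_iff : 1 < P.abv f ↔ f ≠ 0 ∧ P.ord f < 0 := by
  by_cases hf : f = 0
  · simp [hf]
  rw [abv_apply hf, ← zpow_zero (2 : ℝ), zpow_lt_zpow_iff_right₀ one_lt_two]
  simp [hf]

theorem abv_lt_one_iff (hf : f ≠ 0) : P.abv f < 1 ↔ 0 < P.ord f := by
  rw [abv_apply hf, ← zpow_zero (2 : ℝ), zpow_lt_zpow_iff_right₀ one_lt_two]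
  simp

theorem abv_le_one_iff : P.abv f ≤ 1 ↔ f ∈ P.ring := by
  by_cases hf : f = 0
  · simp [hf, P.ring.zero_mem]
  rw [abv_apply hf, ← zpow_zero (2 : ℝ), zpow_le_zpow_iff_right₀ one_lt_two, mem_ring_iff hf]
  simp

theorem isNontrivial_abv (P : Place k F) : P.abv.IsNontrivial := by
  obtain ⟨t, ht⟩ := P.exists_isPrimeElement
  refine ⟨t, ht.coe_ne_zero, ne_of_lt ((abv_lt_one_iff ht.coe_ne_zero).2 ?_)⟩
  have := ht.ord_eq 1 1
  have h1 : (((1 : P.ringˣ) : P.ring) : F) = 1 := rfl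
  rw [zpow_one, h1, mul_one] at this
  omega

theorem eq_of_isEquiv_abv {P Q : Place k F} (h : P.abv.IsEquiv Q.abv) : P = Q := by
  refine ring_injective (SetLike.ext fun f => ?_)
  rw [← abv_le_one_iff, ← abv_le_one_iff]
  exact h.le_one_iff

theorem exists_pow_mul_mem {a : F} (ha : a ≠ 0) (hpos : 0 < P.ord a) (y : F) :
    ∃ N : ℕ, ∀ n ≥ N, a ^ n * y ∈ P.ring := by
  by_cases hy : y = 0
  · exact ⟨0, fun n _ => by rw [hy, mul_zero]; exact P.ring.zero_mem⟩
  refine ⟨(P.ord y).natAbs, fun n hn => ?_⟩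
  rw [mem_ring_iff (mul_ne_zero (pow_ne_zero n ha) hy), ord_mul (pow_ne_zero n ha) hy, ord_pow ha]
  have h1 : (n : ℤ) * 1 ≤ n * P.ord a := mul_le_mul_of_nonneg_left hpos (by positivity)
  omega

theorem inv_one_add_mem {c : F} (hc : c ≠ 0) (hpos : 0 < P.ord c) : (1 + c)⁻¹ ∈ P.ring := by
  by_cases h0 : 1 + c = 0
  · rw [h0, inv_zero]; exact P.ring.zero_mem
  have hcm := (mem_ring_iff hc).2 hpos.le
  have hm := (mem_ring_iff h0).1 (P.ring.add_mem _ _ P.ring.one_mem hcm)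
  rw [mem_ring_iff (inv_ne_zero h0), ord_inv h0]
  by_contra! hlt
  have hsub : (1 + c) + -c ≠ 0 := by simp
  have := min_ord_le_ord_add (P := P) h0 (neg_ne_zero.2 hc) hsub
  rw [add_neg_cancel_right, ord_one, ord_neg hc] at this
  omega

/-- Take `a` with a pole at `P i` and zeros at the other places: `a ^ n / (1 + a ^ n)` tends to 1 at
`P i` and to 0 elsewhere, so a large `n` absorbs the poles of `y`. -/
theorem exists_almost_idempotent {ι : Type*} [Finite ι] {P : ι → Place k F}
    (hP : Function.Injective P) (i : ι) (y : F) :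
    ∃ e : F, (∀ j ≠ i, e * y ∈ (P j).ring) ∧ (e - 1) * y ∈ (P i).ring := by
  have := Fintype.ofFinite ι
  obtain ⟨a, hai, haj⟩ := AbsoluteValue.exists_one_lt_lt_one_pi_of_not_isEquiv
    (v := fun i => (P i).abv) (fun i => (P i).isNontrivial_abv)
    (fun i j hij h => hij (hP (eq_of_isEquiv_abv h))) i
  obtain ⟨ha, hai⟩ := one_lt_abv_iff.1 hai
  have haj : ∀ j ≠ i, 0 < (P j).ord a := fun j hj => (abv_lt_one_iff ha).1 (haj j hj)
  have hai' : 0 < (P i).ord a⁻¹ := by rw [ord_inv ha]; omega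
  choose! N hN using fun j (hj : j ≠ i) => exists_pow_mul_mem ha (haj j hj) y
  obtain ⟨M, hM⟩ := exists_pow_mul_mem (inv_ne_zero ha) hai' y
  obtain ⟨n, hnM, hn1, hn⟩ : ∃ n, M ≤ n ∧ 1 ≤ n ∧ ∀ j, N j ≤ n :=
    ⟨M + 1 + ∑ j, N j, by omega, by omega, fun j =>
      (Finset.single_le_sum (f := N) (fun _ _ => Nat.zero_le _) (Finset.mem_univ j)).trans (by omega)⟩
  have hpow : ∀ (Q : Place k F) (b : F), b ≠ 0 → 0 < Q.ord b → 0 < Q.ord (b ^ n) := by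
    intro Q b hb h
    rw [ord_pow hb]
    positivity
  refine ⟨a ^ n * (1 + a ^ n)⁻¹, fun j hj => ?_, ?_⟩
  · have h := (P j).ring.mul_mem _ _ (hN j hj n (hn j))
      (inv_one_add_mem (pow_ne_zero n ha) (hpow _ a ha (haj j hj)))
    convert h using 1
    ring
  -- With `b = a⁻¹`, one has `e - 1 = -b ^ n / (1 + b ^ n)`.
  · have hb0 := pow_ne_zero n (inv_ne_zero ha)
    have hpos := hpow (P i) _ (inv_ne_zero ha) hai'
    have h := (P i).ring.neg_mem _ ((P i).ring.mul_mem _ _ (hM n hnM) (inv_one_add_mem hb0 hpos))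
    have hne : 1 + a ^ n ≠ 0 := by
      intro h0
      have hone : a ^ n = -1 := by linear_combination h0
      have h1 : (P i).ord (a ^ n * a ^ n) = 0 := by rw [hone, neg_mul_neg, one_mul, ord_one]
      rw [ord_mul (pow_ne_zero n ha) (pow_ne_zero n ha), ord_pow ha] at h1
      have : 0 < (n : ℤ) * -(P i).ord a := by
        have : 0 < -(P i).ord a := by omega
        positivity
      linarith
    have hne' : a ^ n + 1 ≠ 0 := by rwa [add_comm]
    have han := pow_ne_zero n ha
    convert h using 1
    rw [inv_pow]
    field_simp
    ring

/-- Weak approximation for the valuation rings of finitely many places. -/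
theorem exists_sub_mem {ι : Type*} [Finite ι] {P : ι → Place k F} (hP : Function.Injective P)
    {x : F} (hx0 : x ≠ 0) (hx : ∀ i, x ∈ (P i).ring) (a : ∀ i, (P i).ring) :
    ∃ z : F, ∀ i, z ∈ (P i).ring ∧ (z - a i) * x⁻¹ ∈ (P i).ring := by
  classical
  have := Fintype.ofFinite ι
  choose e he he' using fun i => exists_almost_idempotent hP i ((a i : F) * x⁻¹)
  have key : ∀ i, (∑ j, e j * a j - a i) * x⁻¹ ∈ (P i).ring := by
    intro i
    have : (∑ j, e j * a j - a i) * x⁻¹ =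
        (e i - 1) * (a i * x⁻¹) + ∑ j ∈ Finset.univ.erase i, e j * (a j * x⁻¹) := by
      rw [← Finset.add_sum_erase _ _ (Finset.mem_univ i)]
      simp only [← mul_assoc, ← Finset.sum_mul]
      ring
    rw [this]
    exact (P i).ring.add_mem _ _ (he' i)
      (sum_mem fun j hj => he j i (Finset.ne_of_mem_erase hj).symm)
  refine ⟨∑ j, e j * a j, fun i => ⟨?_, key i⟩⟩
  have := (P i).ring.add_mem _ _ ((P i).ring.mul_mem _ _ (key i) (hx i)) (a i).2
  rwa [inv_mul_cancel_right₀ hx0, sub_add_cancel] at this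

/-- The degree of the zeros of `x`, counted with multiplicity, is at most `[F : k(x)]`. -/
theorem sum_ord_mul_degree_le_finrank {ι : Type*} [Fintype ι] {P : ι → Place k F}
    (hP : Function.Injective P) {x : F} (htr : Transcendental k x) (hx : ∀ i, x ∈ (P i).ring) :
    ∑ i, (P i).ord x * (P i).degree ≤
      (Module.finrank (IntermediateField.adjoin k {x}) F : ℤ) := by
  have hx0 : x ≠ 0 := fun h => htr (h ▸ isAlgebraic_zero)
  -- `R/xR` has dimension at most `[F : k(x)]`, and by weak approximation it surjects onto the
  -- product of the `O_{P_i}/(x)`, whose dimension is the sum in question.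
  let R : Subalgebra k F := ⨅ i, (P i).subalgebra
  have hR : ∀ {z : F}, z ∈ R ↔ ∀ i, z ∈ (P i).ring := Algebra.mem_iInf
  let y : R := ⟨x, hR.2 hx⟩
  let xi : ∀ i, (P i).ring := fun i => ⟨x, hx i⟩
  have hxi : ∀ i, xi i ≠ 0 := fun i h => hx0 (congrArg Subtype.val h)
  have hy : y ≠ 0 := fun h => hx0 (congrArg Subtype.val h)
  have hfd : FiniteDimensional (IntermediateField.adjoin k {R.val y}) F :=
    FiniteOverTranscendental.finite_adjoin x htr
  obtain ⟨hfin, hle⟩ := finite_quotient_and_finrank_le R.val Subtype.val_injective hy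
  have hfi : ∀ i, Module.Finite k ((P i).ring ⧸ Ideal.span {xi i}) :=
    fun i => (P i).finite_quotient (hxi i)
  let r : ∀ i, R →ₐ[k] (P i).ring := fun i =>
    { toFun := fun z => ⟨z, hR.1 z.2 i⟩
      map_one' := rfl
      map_mul' := fun _ _ => rfl
      map_zero' := rfl
      map_add' := fun _ _ => rfl
      commutes' := fun _ => rfl }
  let ψ : R →ₗ[k] (∀ i, (P i).ring ⧸ Ideal.span {xi i}) :=
    LinearMap.pi fun i => (Ideal.Quotient.mkₐ k (Ideal.span {xi i})).toLinearMap ∘ₗ (r i).toLinearMap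
  have hψ : ∀ z i, ψ z i = Ideal.Quotient.mk _ (r i z) := fun _ _ => rfl
  have hker : (Ideal.span {y}).restrictScalars k ≤ LinearMap.ker ψ := by
    intro z hz
    obtain ⟨c, rfl⟩ := Ideal.mem_span_singleton.1 hz
    refine LinearMap.mem_ker.2 (funext fun i => ?_)
    rw [hψ, map_mul]
    exact Ideal.Quotient.eq_zero_iff_mem.2 (Ideal.mul_mem_right _ _ (Ideal.mem_span_singleton_self _))
  let Ψ : (R ⧸ Ideal.span {y}) →ₗ[k] (∀ i, (P i).ring ⧸ Ideal.span {xi i}) :=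
    ((Ideal.span {y}).restrictScalars k).liftQ ψ hker
  have hsurj : Function.Surjective Ψ := by
    intro b
    choose a ha using fun i => Ideal.Quotient.mk_surjective (b i)
    obtain ⟨z, hz⟩ := exists_sub_mem hP hx0 hx a
    refine ⟨Ideal.Quotient.mk _ ⟨z, hR.2 fun i => (hz i).1⟩, ?_⟩
    change ψ ⟨z, _⟩ = b
    funext i
    rw [hψ, ← ha i, Ideal.Quotient.eq, Ideal.mem_span_singleton]
    refine ⟨⟨_, (hz i).2⟩, Subtype.ext ?_⟩
    change z - a i = x * ((z - a i) * x⁻¹)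
    field_simp
  have h1 := LinearMap.finrank_le_finrank_of_surjective hsurj
  rw [Module.finrank_pi_fintype] at h1
  have h2 : ∑ i, (P i).ord x * (P i).degree =
      ((∑ i, Module.finrank k ((P i).ring ⧸ Ideal.span {xi i}) : ℕ) : ℤ) := by
    push_cast
    exact Finset.sum_congr rfl fun i _ => (finrank_quotient_span (hxi i)).symm
  rw [h2]
  exact_mod_cast h1.trans hle

end Place

/-! ### Existence of poles and the count of poles -/

/-- The integral closure of `k` in `F` is an intersection of valuation rings, so an element outside
it is missed by one of them. -/
theorem exists_notMem_ring_of_transcendental {f : F} (hf : Transcendental k f) :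
    ∃ Q : Place k F, f ∉ Q.ring := by
  have hfR : f ∉ (integralClosure k F).toSubring := fun h => hf (IsIntegral.isAlgebraic h)
  have : IsIntegrallyClosedIn (integralClosure k F).toSubring F :=
    inferInstanceAs (IsIntegrallyClosedIn (integralClosure k F) F)
  obtain ⟨V, hV, hfV⟩ := Subring.exists_le_valuationSubring_of_isIntegrallyClosedIn hfR
  exact ⟨⟨V, fun c => hV ((integralClosure k F).algebraMap_mem c), fun h => hfV (h ▸ trivial)⟩, hfV⟩

theorem exists_basis_integral {x : F}
    [FiniteDimensional (IntermediateField.adjoin k {x}) F] :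
    ∃ (s : Finset F) (b : Module.Basis s (IntermediateField.adjoin k {x}) F),
      ∀ i, IsIntegral (Algebra.adjoin k {x}) (b i) := by
  open IntermediateField.algebraAdjoinAdjoin in
  exact FiniteDimensional.exists_is_basis_integral (Algebra.adjoin k {x})
    (IntermediateField.adjoin k {x}) F

theorem linearIndependent_pow_mul {x : F} (hx : Transcendental k x) {ι : Type*} {b : ι → F}
    (hb : LinearIndependent (IntermediateField.adjoin k {x}) b) (N : ℕ) :
    LinearIndependent k fun p : Fin N × ι => x ^ (p.1 : ℕ) * b p.2 := by
  let g : IntermediateField.adjoin k {x} := IntermediateField.AdjoinSimple.gen k x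
  have hg : LinearIndependent k fun i : Fin N => g ^ (i : ℕ) := by
    have h1 : LinearIndependent k fun i : ℕ => x ^ i := by
      have := (Polynomial.basisMonomials k).linearIndependent.map' (aeval x).toLinearMap
        (LinearMap.ker_eq_bot.2 (transcendental_iff_injective.1 hx))
      have he : (fun i : ℕ => x ^ i) = (aeval x).toLinearMap ∘ Polynomial.basisMonomials k := by
        funext i
        simp
      rwa [he]
    have h2 : LinearIndependent k fun i : ℕ => g ^ i := by
      refine LinearIndependent.of_comp (IntermediateField.adjoin k {x}).val.toLinearMap ?_
      exact h1
    exact h2.comp _ Fin.val_injective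
  exact linearIndependent_smul hg hb

namespace Place

theorem mem_ring_of_isIntegral (Q : Place k F) {x f : F} (hx : x ∈ Q.ring)
    (hf : IsIntegral (Algebra.adjoin k {x}) f) : f ∈ Q.ring := by
  have hle : Algebra.adjoin k {x} ≤ Q.subalgebra :=
    Algebra.adjoin_le (Set.singleton_subset_iff.2 hx)
  obtain ⟨p, hp, hpf⟩ := hf
  have hint : IsIntegral Q.ring f := by
    let j : Algebra.adjoin k {x} →+* Q.ring :=
      { toFun := fun a => ⟨a, hle a.2⟩
        map_one' := rfl
        map_mul' := fun _ _ => rfl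
        map_zero' := rfl
        map_add' := fun _ _ => rfl }
    refine ⟨p.map j, hp.map j, ?_⟩
    rw [eval₂_map]
    exact hpf
  obtain ⟨a, ha⟩ := IsIntegrallyClosed.isIntegral_iff.1 hint
  exact ha ▸ a.2

variable [FiniteOverTranscendental k F]

/-- The degree of the poles of `x`, counted with multiplicity, is at least `[F : k(x)]`. -/
theorem finrank_le_sum_neg_ord_mul_degree {ι : Type*} [Fintype ι] {P : ι → Place k F} {x : F}
    (htr : Transcendental k x) (hx : ∀ i, x ∉ (P i).ring)
    (hpole : ∀ Q : Place k F, x ∉ Q.ring → Q ∈ Set.range P) :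
    (Module.finrank (IntermediateField.adjoin k {x}) F : ℤ) ≤
      ∑ i, -(P i).ord x * (P i).degree := by
  have hfd := FiniteOverTranscendental.finite_adjoin x htr
  have hx0 : x ≠ 0 := fun h => htr (h ▸ isAlgebraic_zero)
  have hord : ∀ i, 0 < (P i).ord x⁻¹ := fun i => by
    have := (mem_ring_iff hx0).not.1 (hx i)
    rw [ord_inv hx0]
    omega
  have hy : ∀ i, x⁻¹ ∈ (P i).ring := fun i => ((P i).ring.mem_or_inv_mem x).resolve_left (hx i)
  obtain ⟨s, b, hb⟩ := exists_basis_integral (k := k) (x := x)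
  -- `c` bounds the poles of the whole integral basis at the poles of `x`, independently of `l`
  -- below.
  obtain ⟨c, hc⟩ : ∃ c : ℕ, ∀ i j, x⁻¹ ^ c * b j ∈ (P i).ring := by
    choose N hN using fun i (j : s) => exists_pow_mul_mem (inv_ne_zero hx0) (hord i) (b j)
    refine ⟨∑ i, ∑ j, N i j, fun i j => hN i j _ ?_⟩
    exact (Finset.single_le_sum (f := fun j => N i j) (fun _ _ => Nat.zero_le _)
      (Finset.mem_univ j)).trans (Finset.single_le_sum (f := fun i => ∑ j, N i j)
        (fun _ _ => Nat.zero_le _) (Finset.mem_univ i))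
  obtain ⟨Q₀, hQ₀⟩ := exists_notMem_ring_of_transcendental htr
  obtain ⟨i₀, -⟩ := hpole Q₀ hQ₀
  let yi : ∀ i, (P i).ring := fun i => ⟨x⁻¹, hy i⟩
  have hyi : ∀ i, yi i ≠ 0 := fun i h => inv_ne_zero hx0 (congrArg Subtype.val h)
  -- The left side is the dimension of the span of the `x ^ m * b j` with `m ≤ l`; the right side is
  -- that of the product of the `O_{P_i}/(x⁻¹ ^ (l + 1 + c))`, into which the span embeds.
  have key : ∀ l : ℕ, ((l : ℤ) + 1) * s.card ≤
      (l + 1 + c) * ∑ i, -(P i).ord x * (P i).degree := by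
    intro l
    let T : (Fin (l + 1) × s → k) →ₗ[k] F :=
      Fintype.linearCombination k fun p => x ^ (p.1 : ℕ) * b p.2
    have hTapp : ∀ v, T v = ∑ p, v p • (x ^ (p.1 : ℕ) * b p.2) :=
      fun v => Fintype.linearCombination_apply k _ v
    have hT : ∀ v, T v = 0 → v = 0 := fun v hv =>
      funext (Fintype.linearIndependent_iff.1
        (linearIndependent_pow_mul htr b.linearIndependent (l + 1)) v ((hTapp v).symm.trans hv))
    have hmem : ∀ v i, x⁻¹ ^ (l + c) * T v ∈ (P i).ring := by
      intro v i
      rw [hTapp, Finset.mul_sum]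
      refine sum_mem fun p _ => ?_
      have hp : (p.1 : ℕ) ≤ l := Nat.lt_succ_iff.1 p.1.2
      have h := (P i).ring.mul_mem _ _ (pow_mem (hy i) (l - p.1)) (hc i p.2)
      have h' := (P i).subalgebra.smul_mem h (v p)
      convert h' using 1
      have hpow : x⁻¹ ^ (l + c) * x ^ (p.1 : ℕ) = x⁻¹ ^ (l - p.1) * x⁻¹ ^ c := by
        rw [show l + c = (l - p.1) + c + p.1 by omega, pow_add, pow_add, mul_assoc, inv_pow x p.1,
          inv_mul_cancel₀ (pow_ne_zero _ hx0), mul_one]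
      rw [mul_smul_comm, ← mul_assoc, hpow, mul_assoc]
      rfl
    let S : ∀ i, (Fin (l + 1) × s → k) →ₗ[k] (P i).ring := fun i =>
      { toFun := fun v => ⟨_, hmem v i⟩
        map_add' := fun v w => Subtype.ext (by
          change x⁻¹ ^ (l + c) * T (v + w) = x⁻¹ ^ (l + c) * T v + x⁻¹ ^ (l + c) * T w
          rw [map_add, mul_add])
        map_smul' := fun a v => Subtype.ext (by
          change x⁻¹ ^ (l + c) * T (a • v) = algebraMap k F a * (x⁻¹ ^ (l + c) * T v)
          rw [map_smul, Algebra.smul_def, mul_left_comm]) }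
    let Ψ : (Fin (l + 1) × s → k) →ₗ[k] (∀ i, (P i).ring ⧸ Ideal.span {yi i ^ (l + 1 + c)}) :=
      LinearMap.pi fun i =>
        (Ideal.Quotient.mkₐ k (Ideal.span {yi i ^ (l + 1 + c)})).toLinearMap ∘ₗ S i
    -- The exponent exceeds `l + c` by one, so a kernel element vanishes at every pole of `x`.
    -- Elsewhere it is integral over `k[x]`. It has no pole, hence is algebraic, which its zero at
    -- `P i₀` forbids unless it is 0.
    have hΨ : Function.Injective Ψ := by
      rw [injective_iff_map_eq_zero]
      intro v hv
      by_contra hv0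
      have hf0 : T v ≠ 0 := fun h => hv0 (hT v h)
      have hzero : ∀ i, 0 < (P i).ord (T v) := by
        intro i
        have h := congrFun hv i
        obtain ⟨a, ha⟩ := Ideal.mem_span_singleton.1 (Ideal.Quotient.eq_zero_iff_mem.1 h)
        have ha' : x⁻¹ ^ (l + c) * T v = x⁻¹ ^ (l + 1 + c) * (a : F) := congrArg Subtype.val ha
        have hTa : T v = x⁻¹ * a := by
          have hne := pow_ne_zero (l + c) (inv_ne_zero hx0)
          apply mul_left_cancel₀ hne
          rw [ha']
          ring
        have ha0 : (a : F) ≠ 0 := fun h => hf0 (by rw [hTa, h, mul_zero])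
        rw [hTa, ord_mul (inv_ne_zero hx0) ha0]
        have := (mem_ring_iff ha0).1 a.2
        have := hord i
        omega
      have htrf := transcendental_of_ord_ne_zero hf0 (hzero i₀).ne'
      obtain ⟨Q, hQ⟩ := exists_notMem_ring_of_transcendental htrf
      apply hQ
      by_cases hxQ : x ∈ Q.ring
      · rw [hTapp]
        refine sum_mem fun p _ => Q.subalgebra.smul_mem ?_ _
        exact Q.ring.mul_mem _ _ (pow_mem hxQ _) (Q.mem_ring_of_isIntegral hxQ (hb _))
      · obtain ⟨i, rfl⟩ := hpole Q hxQ
        exact (mem_ring_iff hf0).2 (hzero i).le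
    have hfi : ∀ i, Module.Finite k ((P i).ring ⧸ Ideal.span {yi i ^ (l + 1 + c)}) :=
      fun i => (P i).finite_quotient (pow_ne_zero _ (hyi i))
    have h1 := LinearMap.finrank_le_finrank_of_injective hΨ
    rw [Module.finrank_fintype_fun_eq_card, Module.finrank_pi_fintype, Fintype.card_prod,
      Fintype.card_fin, Fintype.card_coe] at h1
    have h2 : ((l : ℤ) + 1 + c) * ∑ i, -(P i).ord x * (P i).degree =
        ((∑ i, Module.finrank k ((P i).ring ⧸ Ideal.span {yi i ^ (l + 1 + c)}) : ℕ) : ℤ) := by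
      push_cast
      rw [Finset.mul_sum]
      refine Finset.sum_congr rfl fun i _ => ?_
      rw [finrank_quotient_span (pow_ne_zero _ (hyi i))]
      have : (P i).ord ((yi i ^ (l + 1 + c) : (P i).ring) : F) = (l + 1 + c) * -(P i).ord x := by
        change (P i).ord (x⁻¹ ^ (l + 1 + c)) = _
        rw [ord_pow (inv_ne_zero hx0), ord_inv hx0]
        push_cast
        ring
      rw [this]
      ring
    rw [h2]
    exact_mod_cast h1
  rw [Module.finrank_eq_card_basis b, Fintype.card_coe]
  generalize hd : ∑ i, -(P i).ord x * (P i).degree = d at key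
  by_contra! hlt
  have h0 : 0 ≤ d := by
    rw [← hd]
    refine Finset.sum_nonneg fun i _ => mul_nonneg ?_ (by positivity)
    have := hord i
    rw [ord_inv hx0] at this
    exact this.le
  -- With `l = c * d` and `s.card ≥ d + 1`, the estimate would give `(c d + 1)(d + 1) ≤ (c d + 1 +
  -- c) d`, where the left side is larger by 1.
  have h3 := key (c * d.toNat)
  have h4 : ((d.toNat : ℕ) : ℤ) = d := Int.toNat_of_nonneg h0
  push_cast at h3
  rw [h4] at h3
  have h5 : ((c : ℤ) * d + 1) * (d + 1) ≤ (c * d + 1) * s.card :=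
    mul_le_mul_of_nonneg_left (by omega) (by positivity)
  nlinarith

end Place

/-! ### Riemann–Roch spaces and the degree argument -/

theorem Divisor.degree_eq_sum {A : Divisor k F} {S : Finset (Place k F)} (hS : A.support ⊆ S) :
    A.degree = ∑ Q ∈ S, A Q * (Q.degree : ℤ) :=
  Finsupp.sum_of_support_subset A hS _ fun _ _ => zero_mul _

theorem sumOfPlaces_apply_ne_zero {n : ℕ} (P : Fin n → Place k F) (i : Fin n) :
    sumOfPlaces P (P i) ≠ 0 := by
  classical
  rw [sumOfPlaces, Finsupp.finsetSum_apply]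
  refine ne_of_gt (Finset.sum_pos' (fun j _ => ?_) ⟨i, Finset.mem_univ i, ?_⟩)
  · rw [Finsupp.single_apply]; split_ifs <;> simp
  · simp

theorem apply_eq_zero_of_disjoint {n : ℕ} {P : Fin n → Place k F} {G : Divisor k F}
    (hG : Disjoint G.support (sumOfPlaces P).support) (i : Fin n) : G (P i) = 0 := by
  by_contra h
  exact Finset.disjoint_left.1 hG (Finsupp.mem_support_iff.2 h)
    (Finsupp.mem_support_iff.2 (sumOfPlaces_apply_ne_zero P i))

theorem Place.sub_mem_maximalIdeal_of_evalAt_eq {P : Place k F} (hP : P.IsRational) {a b : P.ring}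
    (h : P.evalAt hP a = P.evalAt hP b) : a - b ∈ IsLocalRing.maximalIdeal P.ring :=
  Ideal.Quotient.eq.1 <|
    (AlgEquiv.ofBijective (Algebra.ofId k P.ResidueField) hP.bijective).symm.injective h

theorem riemannRochSpace_mono {G H : Divisor k F} (h : G ≤ H) :
    riemannRochSpace G ⊆ riemannRochSpace H := by
  rintro f (⟨hf, hG⟩ | rfl)
  · exact Or.inl ⟨hf, fun Q => (neg_le_neg (h Q)).trans (hG Q)⟩
  · exact Or.inr rfl

theorem riemannRochSpace_inter (G H : Divisor k F) :
    riemannRochSpace G ∩ riemannRochSpace H ⊆ riemannRochSpace (G ⊓ H) := by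
  rintro f ⟨⟨hf, hG⟩ | h0, h⟩
  · rcases h with ⟨-, hH⟩ | h0
    · refine Or.inl ⟨hf, fun Q => ?_⟩
      have h1 := hG Q
      have h2 := hH Q
      rw [Finsupp.inf_apply]
      rcases min_choice (G Q) (H Q) with h | h <;> rw [h] <;> assumption
    · exact Or.inr h0
  · exact Or.inr h0

variable [FiniteOverTranscendental k F]

theorem sub_mem_riemannRochSpace {G : Divisor k F} {f g : F} (hf : f ∈ riemannRochSpace G)
    (hg : g ∈ riemannRochSpace G) : f - g ∈ riemannRochSpace G := by
  have hneg : -g ∈ riemannRochSpace G := by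
    rcases hg with ⟨hg, h⟩ | rfl
    · refine Or.inl ⟨neg_ne_zero.2 hg, fun Q => ?_⟩
      rw [Place.ord_neg hg]
      exact h Q
    · exact Or.inr neg_zero
  rw [sub_eq_add_neg]
  generalize -g = g at hneg
  rcases hf with ⟨hf, hG⟩ | rfl
  · rcases hneg with ⟨hg, hH⟩ | rfl
    · by_cases h0 : f + g = 0
      · exact Or.inr h0
      · exact Or.inl ⟨h0, fun Q =>
          (le_min (hG Q) (hH Q)).trans (Place.min_ord_le_ord_add hf hg h0)⟩
    · rw [add_zero]
      exact Or.inl ⟨hf, hG⟩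
  · rwa [zero_add]

/-- Summed over a finite set of places containing all poles, a principal divisor has nonpositive
degree. -/
theorem sum_ord_mul_degree_nonpos {h : F} (htr : Transcendental k h) (S : Finset (Place k F))
    (hS : ∀ Q : Place k F, h ∉ Q.ring → Q ∈ S) : ∑ Q ∈ S, Q.ord h * (Q.degree : ℤ) ≤ 0 := by
  classical
  have h0 : h ≠ 0 := fun h0 => htr (h0 ▸ isAlgebraic_zero)
  let Z := S.filter fun Q => h ∈ Q.ring
  let I := S.filter fun Q => h ∉ Q.ring
  have hz := Place.sum_ord_mul_degree_le_finrank (P := fun Q : Z => Q.1) Subtype.val_injective htr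
    (fun Q => (Finset.mem_filter.1 Q.2).2)
  have hp := Place.finrank_le_sum_neg_ord_mul_degree (P := fun Q : I => Q.1) htr
    (fun Q => (Finset.mem_filter.1 Q.2).2)
    (fun Q hQ => ⟨⟨Q, Finset.mem_filter.2 ⟨hS Q hQ, hQ⟩⟩, rfl⟩)
  have hz' : ∑ Q ∈ Z, Q.ord h * (Q.degree : ℤ) ≤
      Module.finrank (IntermediateField.adjoin k {h}) F := by
    rw [← Finset.sum_coe_sort]
    exact hz
  have hp' : (Module.finrank (IntermediateField.adjoin k {h}) F : ℤ) ≤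
      -∑ Q ∈ I, Q.ord h * (Q.degree : ℤ) := by
    rw [← Finset.sum_coe_sort, ← Finset.sum_neg_distrib]
    simpa only [neg_mul] using hp
  have hsplit : ∑ Q ∈ S, Q.ord h * (Q.degree : ℤ) =
      ∑ Q ∈ Z, Q.ord h * (Q.degree : ℤ) + ∑ Q ∈ I, Q.ord h * (Q.degree : ℤ) :=
    (Finset.sum_filter_add_sum_filter_not S _ _).symm
  linarith

/-- A nonzero element of `L(A)` that vanishes at `n` rational places outside the support of `A`
forces `n ≤ deg A`. -/
theorem le_degree_of_vanishing {n : ℕ} {P : Fin n → Place k F} (hP : ∀ i, (P i).IsRational)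
    (hinj : Function.Injective P) {A : Divisor k F} (hA : ∀ i, A (P i) = 0) {h : F} (h0 : h ≠ 0)
    (hL : ∀ Q : Place k F, -(A Q) ≤ Q.ord h) (hv : ∀ i, 0 < (P i).ord h) :
    (n : ℤ) ≤ A.degree := by
  classical
  -- A pole of `h` forces a positive coefficient of `A`, so `S` contains all poles.
  let S : Finset (Place k F) := A.support ∪ Finset.univ.image P
  have hPS : Finset.univ.image P ⊆ S := Finset.subset_union_right
  rw [Divisor.degree_eq_sum (S := S) Finset.subset_union_left]
  have hsum : ∑ Q ∈ S, Q.ord h * (Q.degree : ℤ) ≤ 0 := by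
    by_cases htr : Transcendental k h
    · refine sum_ord_mul_degree_nonpos htr S fun Q hQ => ?_
      have h1 := (Place.mem_ring_iff h0).not.1 hQ
      have h2 := hL Q
      exact Finset.mem_union_left _ (Finsupp.mem_support_iff.2 (by omega))
    · refine Finset.sum_nonpos fun Q _ => ?_
      have : Q.ord h = 0 := by
        by_contra hne
        exact htr (Place.transcendental_of_ord_ne_zero h0 hne)
      rw [this, zero_mul]
  -- `A + (h)` is effective, and each `P i`, of degree 1, contributes at least 1.
  have hle : (n : ℤ) ≤ ∑ Q ∈ S, (A Q + Q.ord h) * (Q.degree : ℤ) := by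
    calc (n : ℤ) = ∑ Q ∈ Finset.univ.image P, 1 := by
          rw [Finset.sum_image fun _ _ _ _ h => hinj h]; simp
      _ ≤ ∑ Q ∈ Finset.univ.image P, (A Q + Q.ord h) * (Q.degree : ℤ) := by
          refine Finset.sum_le_sum fun Q hQ => ?_
          obtain ⟨i, -, rfl⟩ := Finset.mem_image.1 hQ
          have hd : (P i).degree = 1 := hP i
          rw [hA i, hd]
          have := hv i
          push_cast
          omega
      _ ≤ _ := Finset.sum_le_sum_of_subset_of_nonneg hPS fun Q _ _ =>
          mul_nonneg (by have := hL Q; omega) (by positivity)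
  simp only [add_mul, Finset.sum_add_distrib] at hle
  omega

end AGCode

theorem mainTheorem10 {k F : Type*} [Field k] [Finite k] [Field F] [Algebra k F]
    [Algebra (RatFunc k) F] [IsScalarTower k (RatFunc k) F] [FunctionField k F]
    {n : ℕ} (P : Fin n → AGCode.Place k F) (hP : ∀ i, (P i).IsRational)
    (hinj : Function.Injective P)
    (G₁ G₂ : AGCode.Divisor k F)
    (hG₁ : Disjoint G₁.support (AGCode.sumOfPlaces P).support)
    (hG₂ : Disjoint G₂.support (AGCode.sumOfPlaces P).support)
    (hdeg : AGCode.Divisor.degree (G₁ ⊔ G₂) < (n : ℤ)) :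
    AGCode.code P hP G₁ ∩ AGCode.code P hP G₂ = AGCode.code P hP (G₁ ⊓ G₂) := by
  have : AGCode.FiniteOverTranscendental k F :=
    ⟨fun _ => AGCode.finiteDimensional_adjoin_of_transcendental⟩
  apply Set.Subset.antisymm
  · rintro c ⟨⟨f, hf, hfm, hcf⟩, ⟨g, hg, hgm, hcg⟩⟩
    suffices hfg : f - g = 0 by
      obtain rfl := sub_eq_zero.1 hfg
      exact ⟨f, AGCode.riemannRochSpace_inter _ _ ⟨hf, hg⟩, hfm, hcf⟩
    rcases AGCode.sub_mem_riemannRochSpace (AGCode.riemannRochSpace_mono le_sup_left hf)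
      (AGCode.riemannRochSpace_mono le_sup_right hg) with ⟨h0, hL⟩ | h0
    · refine absurd (AGCode.le_degree_of_vanishing hP hinj (fun i => ?_) h0 hL fun i => ?_)
        hdeg.not_ge
      · rw [Finsupp.sup_apply, AGCode.apply_eq_zero_of_disjoint hG₁,
          AGCode.apply_eq_zero_of_disjoint hG₂, sup_idem]
      · have hne : (⟨f, hfm i⟩ - ⟨g, hgm i⟩ : (P i).ring) ≠ 0 :=
          fun h => h0 (congrArg Subtype.val h)
        refine (AGCode.Place.mem_maximalIdeal_iff hne).1 ?_
        exact AGCode.Place.sub_mem_maximalIdeal_of_evalAt_eq (hP i)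
          (congrFun (hcf.symm.trans hcg) i)
    · exact h0
  · rintro c ⟨f, hf, hfm, hc⟩
    exact ⟨⟨f, AGCode.riemannRochSpace_mono inf_le_left hf, hfm, hc⟩,
      ⟨f, AGCode.riemannRochSpace_mono inf_le_right hf, hfm, hc⟩⟩
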